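/- Consider a random two-player game $G(2,n)$ in which Row has the $2$ actions $\{1,2\}$ and Column has the $n$ actions $\{1,\dots,n\}$. For each action of Column, Row's ranking of her two actions is a uniformly random permutation; for each action of Row, Column's ranking of his $n$ actions is a uniformly random permutation; and all these rankings are mutually independent. An action of a player is strictly dominated in a (sub)game if some other pure action of that player available in the (sub)game is better against every remaining action of the opponent. Let $S^C(2,n)$ be the number of Column's actions that survive iterated elimination of strictly dominated actions (in each iteration both players delete all their strictly dominated actions, until there are none). Then, as $n\to\infty$, $$\Pr\left(S^C(2,n)-\mathbb{E}\left[S^C(2,n)\right]\le x\cdot\sqrt{\mathrm{Var}\left[S^C(2,n)\right]}\right)=\Phi(x)+\mathcal{O}\left(\frac{1}{\sqrt{\ln n}}\right)$$ uniformly in $x\in\mathbb{R}$, where $\Phi$ is the distribution function of the standard normal distribution; that is, there is a constant $K$ such that for all $n\ge 2$ and all $x\in\mathbb{R}$ the two sides without the error term differ by at most $K/\sqrt{\ln n}$. Moreover, with $\gamma$ the Euler–Mascheroni constant, $$\mathbb{E}\left[S^C(2,n)\right]=\ln n+\gamma+o(1),\qquad \sqrt{\mathrm{Var}\left[S^C(2,n)\right]}=\sqrt{\ln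 n}-\frac{\pi^2-6\gamma}{12\sqrt{\ln n}}+o\left(\frac{1}{\sqrt{\ln n}}\right).$$ -/

import Mathlib

open MeasureTheory ProbabilityTheory Filter Asymptotics

/-- A two-player game in normal form with `m` actions for Row and `n` actions for Column.
`R i j` and `C i j` are the payoffs of Row and of Column when Row plays `i` and Column plays `j`. -/
structure BimatrixGame (m n : ℕ) where
  R : Matrix (Fin m) (Fin n) ℝ
  C : Matrix (Fin m) (Fin n) ℝ

namespace BimatrixGame

variable {m n : ℕ}

/-- In the subgame in which Column is restricted to the actions in `B`, Row's action `i` is worse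
than Row's action `i'` whatever Column plays. -/
def RowDominatedBy (g : BimatrixGame m n) (B : Finset (Fin n)) (i i' : Fin m) : Prop :=
  ∀ j ∈ B, g.R i j < g.R i' j

/-- In the subgame in which Row is restricted to the actions in `A`, Column's action `j` is worse
than Column's action `j'` whatever Row plays. -/
def ColDominatedBy (g : BimatrixGame m n) (A : Finset (Fin m)) (j j' : Fin n) : Prop :=
  ∀ i ∈ A, g.C i j < g.C i j'

open Classical in
/-- One iteration of the elimination procedure, on the subgame with action sets `S.1` for Row and
`S.2` for Column: both players simultaneously delete all their actions that are strictly dominated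
in this subgame by another pure action of the subgame. -/
noncomputable def eliminate (g : BimatrixGame m n) (S : Finset (Fin m) × Finset (Fin n)) :
    Finset (Fin m) × Finset (Fin n) :=
  (S.1.filter fun i => ¬ ∃ i' ∈ S.1, g.RowDominatedBy S.2 i i',
   S.2.filter fun j => ¬ ∃ j' ∈ S.2, g.ColDominatedBy S.1 j j')

/-- The action sets that are left after `k` iterations, starting from the full game. -/
noncomputable def remaining (g : BimatrixGame m n) (k : ℕ) : Finset (Fin m) × Finset (Fin n) :=
  g.eliminate^[k] (Finset.univ, Finset.univ)

open Classical in
/-- Column's actions that survive iterated elimination of strictly dominated actions: those that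
are never deleted. -/
noncomputable def survivingCols (g : BimatrixGame m n) : Finset (Fin n) :=
  Finset.univ.filter fun j => ∀ k : ℕ, j ∈ (g.remaining k).2

end BimatrixGame

instance permFinMeasurableSpace (k : ℕ) : MeasurableSpace (Equiv.Perm (Fin k)) := ⊤

instance permFinDiscreteMeasurableSpace (k : ℕ) :
    DiscreteMeasurableSpace (Equiv.Perm (Fin k)) :=
  ⟨fun _ => MeasurableSpace.measurableSet_top⟩

/-- A profile of ordinal rankings: for each action `j` of Column, Row's ranking of Row's actions,
and for each action `i` of Row, Column's ranking of Column's actions. -/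
abbrev RankingProfile (m n : ℕ) : Type :=
  (Fin n → Equiv.Perm (Fin m)) × (Fin m → Equiv.Perm (Fin n))

/-- The game whose payoffs are the ranks, in `{1, …, m}` for Row and in `{1, …, n}` for Column. -/
noncomputable def RankingProfile.game {m n : ℕ} (ω : RankingProfile m n) : BimatrixGame m n where
  R := fun i j => (ω.1 j i : ℕ) + 1
  C := fun i j => (ω.2 i j : ℕ) + 1

/-- The law of the random game `G(m,n)`: all the rankings are uniformly distributed permutations,
and they are mutually independent. -/
noncomputable def randomGame (m n : ℕ) : Measure (RankingProfile m n) :=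
  (Measure.pi fun _ : Fin n => uniformOn (Set.univ : Set (Equiv.Perm (Fin m)))).prod
    (Measure.pi fun _ : Fin m => uniformOn (Set.univ : Set (Equiv.Perm (Fin n))))

/-- The random variable `S^C(m,n)`: the number of Column's surviving actions. -/
noncomputable def numSurvivingCols (m n : ℕ) (ω : RankingProfile m n) : ℝ :=
  (ω.game.survivingCols.card : ℝ)

/-- The expectation of `S^C(m,n)`. -/
noncomputable def meanSurvivingCols (m n : ℕ) : ℝ :=
  ∫ ω, numSurvivingCols m n ω ∂(randomGame m n)

/-- The standard deviation of `S^C(m,n)`. -/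
noncomputable def sdSurvivingCols (m n : ℕ) : ℝ :=
  √(variance (numSurvivingCols m n) (randomGame m n))

/-! With high probability only the first round deletes anything. List the columns by their rank in
Row's first action: a column is undominated in the full game iff it is a right-to-left maximum of
the ranking in Row's second action. The relabelled ranking is a uniform permutation, so the number
`R` of undominated columns is a sum of independent indicators with probabilities `1/(k+1)`, `k < n`
(`Equiv.Perm.sum_numRecords`). Its mean is the harmonic number `H_n = ln n + γ + o(1)`, its variance
`H_n - ∑ 1/k² = ln n + γ - π²/6 + o(1)`.

Elimination goes on only if Row orders her two actions alike against all `R` columns. Row's rankings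
are independent of Column's, so given `R` this has probability at most `2 · 2^{-R}`. Since
`E[(3/4)^R] ≤ exp(-H_n/4)`, passing from `S^C` to `R` costs little for indicators and for first and
second moments (`RankingProfile.integral_abs_sub_le`, `pbMean_rowElimination_le`).

Normal approximation of `R` is Stein's method (`pbMean.berryEsseen`): the Stein equation turns the
error into a comparison of `f'` with difference quotients of `f`. These are close except where a
step crosses the jump of `f'`, and a concentration inequality shows that this is rare. -/

/-! ### Sums of independent indicators -/

/-- The expectation of `h R`, where `R` is the number of successes in independent trials indexed by
`s`, the `i`-th of which succeeds with probability `p i`. -/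
noncomputable def pbMean {ι : Type*} [DecidableEq ι] (p : ι → ℝ) (s : Finset ι) (h : ℕ → ℝ) : ℝ :=
  ∑ t ∈ s.powerset, (∏ i ∈ t, p i) * (∏ i ∈ s \ t, (1 - p i)) * h t.card

namespace pbMean

variable {ι : Type*} [DecidableEq ι] {p : ι → ℝ} {s : Finset ι}

theorem empty (h : ℕ → ℝ) : pbMean p ∅ h = h 0 := by
  simp [pbMean]

theorem insert {a : ι} (ha : a ∉ s) (h : ℕ → ℝ) :
    pbMean p (insert a s) h = p a * pbMean p s (fun r => h (r + 1)) + (1 - p a) * pbMean p s h := by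
  unfold pbMean
  rw [Finset.sum_powerset_insert ha, Finset.mul_sum, Finset.mul_sum, add_comm]
  congr 1
  · refine Finset.sum_congr rfl fun t ht => ?_
    have hat : a ∉ t := fun h => ha (Finset.mem_powerset.1 ht h)
    rw [Finset.prod_insert hat, Finset.card_insert_of_notMem hat,
      Finset.insert_sdiff_insert, Finset.sdiff_insert_of_notMem ha]
    ring
  · refine Finset.sum_congr rfl fun t ht => ?_
    have hat : a ∉ t := fun h => ha (Finset.mem_powerset.1 ht h)
    rw [Finset.insert_sdiff_of_notMem _ hat, Finset.prod_insert (by simp [ha])]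
    ring

theorem erase {a : ι} (ha : a ∈ s) (h : ℕ → ℝ) :
    pbMean p s h = p a * pbMean p (s.erase a) (fun r => h (r + 1))
      + (1 - p a) * pbMean p (s.erase a) h := by
  conv_lhs => rw [← Finset.insert_erase ha]
  exact insert (Finset.notMem_erase a s) h

theorem add (h g : ℕ → ℝ) :
    pbMean p s (fun r => h r + g r) = pbMean p s h + pbMean p s g := by
  simp [pbMean, mul_add, Finset.sum_add_distrib]

theorem sub (h g : ℕ → ℝ) :
    pbMean p s (fun r => h r - g r) = pbMean p s h - pbMean p s g := by
  simp [pbMean, mul_sub, Finset.sum_sub_distrib]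

theorem const_mul (c : ℝ) (h : ℕ → ℝ) :
    pbMean p s (fun r => c * h r) = c * pbMean p s h := by
  simp only [pbMean, Finset.mul_sum]
  exact Finset.sum_congr rfl fun t _ => by ring

theorem const (c : ℝ) : pbMean p s (fun _ => c) = c := by
  induction s using Finset.induction_on with
  | empty => exact empty _
  | insert a s ha ih => rw [insert ha, ih]; ring

theorem mono (hp0 : ∀ i, 0 ≤ p i) (hp1 : ∀ i, p i ≤ 1) {h g : ℕ → ℝ} (hle : ∀ r, h r ≤ g r) :
    pbMean p s h ≤ pbMean p s g := by
  refine Finset.sum_le_sum fun t _ => mul_le_mul_of_nonneg_left (hle _) ?_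
  exact mul_nonneg (Finset.prod_nonneg fun i _ => hp0 i)
    (Finset.prod_nonneg fun i _ => sub_nonneg.2 (hp1 i))

theorem abs_le (hp0 : ∀ i, 0 ≤ p i) (hp1 : ∀ i, p i ≤ 1) {h g : ℕ → ℝ} (hle : ∀ r, |h r| ≤ g r) :
    |pbMean p s h| ≤ pbMean p s g := by
  rw [_root_.abs_le]
  constructor
  · have := mono (s := s) hp0 hp1 (h := fun r => -1 * g r) (g := h)
      fun r => by linarith [(_root_.abs_le.1 (hle r)).1]
    rw [const_mul] at this
    linarith
  · exact mono hp0 hp1 fun r => (_root_.abs_le.1 (hle r)).2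

theorem pow (c : ℝ) : pbMean p s (fun r => c ^ r) = ∏ i ∈ s, (1 - (1 - c) * p i) := by
  induction s using Finset.induction_on with
  | empty => simp [empty]
  | insert a s ha ih =>
    rw [insert ha, Finset.prod_insert ha, ← ih]
    simp only [pow_succ']
    rw [const_mul]
    ring

/-- Size biasing: write the count as a sum of indicators; given that trial `i` succeeds, the count
is one more than that of the other trials. -/
theorem natCast_mul (g : ℕ → ℝ) :
    pbMean p s (fun r => (r : ℝ) * g r)
      = ∑ i ∈ s, p i * pbMean p (s.erase i) (fun r => g (r + 1)) := by
  induction s using Finset.induction_on generalizing g with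
  | empty => simp [empty]
  | insert a s ha ih =>
    rw [insert ha, Finset.sum_insert ha, Finset.erase_insert ha]
    have h1 : pbMean p s (fun r => ((r + 1 : ℕ) : ℝ) * g (r + 1))
        = pbMean p s (fun r => (r : ℝ) * g (r + 1)) + pbMean p s (fun r => g (r + 1)) := by
      rw [← add]
      congr 1
      ext r
      push_cast
      ring
    have h2 : ∀ i ∈ s, p i * pbMean p ((Insert.insert a s).erase i) (fun r => g (r + 1))
        = p a * (p i * pbMean p (s.erase i) (fun r => g (r + 1 + 1)))
          + (1 - p a) * (p i * pbMean p (s.erase i) (fun r => g (r + 1))) := by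
      intro i hi
      have hia : i ≠ a := fun h => ha (h ▸ hi)
      rw [Finset.erase_insert_of_ne hia.symm, insert (fun h => ha (Finset.mem_of_mem_erase h))]
      ring
    rw [h1, ih (fun r => g (r + 1)), ih g, Finset.sum_congr rfl h2, Finset.sum_add_distrib,
      ← Finset.mul_sum, ← Finset.mul_sum]
    ring

/-- The Stein identity for sums of independent indicators. -/
theorem sub_mean_mul (g : ℕ → ℝ) :
    pbMean p s (fun r => ((r : ℝ) - ∑ i ∈ s, p i) * g r)
      = ∑ i ∈ s, p i * (1 - p i) * pbMean p (s.erase i) (fun r => g (r + 1) - g r) := by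
  simp only [sub_mul, sub]
  rw [natCast_mul, const_mul, Finset.sum_mul, ← Finset.sum_sub_distrib]
  refine Finset.sum_congr rfl fun i hi => ?_
  rw [erase hi g]
  ring

theorem natCast : pbMean p s (fun r => (r : ℝ)) = ∑ i ∈ s, p i := by
  simpa [const] using natCast_mul (p := p) (s := s) (fun _ => 1)

theorem sub_mean_sq :
    pbMean p s (fun r => ((r : ℝ) - ∑ i ∈ s, p i) ^ 2) = ∑ i ∈ s, p i * (1 - p i) := by
  simp only [pow_two]
  rw [sub_mean_mul]
  refine Finset.sum_congr rfl fun i _ => ?_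
  have : (fun r : ℕ => (((r + 1 : ℕ) : ℝ) - ∑ i ∈ s, p i) - ((r : ℝ) - ∑ i ∈ s, p i))
      = fun _ => 1 := by
    ext r; push_cast; ring
  rw [this, const, mul_one]

theorem abs_sub_mean_le (hp0 : ∀ i, 0 ≤ p i) (hp1 : ∀ i, p i ≤ 1) {σ : ℝ} (hσ : 0 < σ)
    (hv : ∑ i ∈ s, p i * (1 - p i) = σ ^ 2) :
    pbMean p s (fun r => |(r : ℝ) - ∑ i ∈ s, p i|) ≤ σ := by
  -- AM-GM in place of Cauchy–Schwarz: `|y| ≤ y²/(2σ) + σ/2`.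
  have h1 : ∀ r : ℕ, |(r : ℝ) - ∑ i ∈ s, p i|
      ≤ (1 / (2 * σ)) * ((r : ℝ) - ∑ i ∈ s, p i) ^ 2 + σ / 2 := by
    intro r
    rw [← sq_abs]
    set y := |(r : ℝ) - ∑ i ∈ s, p i|
    have : 1 / (2 * σ) * y ^ 2 + σ / 2 - y = (y - σ) ^ 2 / (2 * σ) := by
      field_simp
      ring
    have h2 : 0 ≤ (y - σ) ^ 2 / (2 * σ) := by positivity
    linarith
  refine (mono hp0 hp1 h1).trans ?_
  rw [add, const_mul, const, sub_mean_sq, hv]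
  apply le_of_eq
  field_simp
  ring

/-- The number of successes in independent trials does not concentrate: the probability that the
number of successes in all trials but one is the last integer to satisfy `q` is small on average. -/
theorem concentration (hp0 : ∀ i, 0 ≤ p i) (hp1 : ∀ i, p i ≤ 1) {σ : ℝ} (hσ : 0 < σ)
    (hv : ∑ i ∈ s, p i * (1 - p i) = σ ^ 2) (q : ℕ → Prop) [DecidablePred q]
    (hq : ∀ r, q (r + 1) → q r) :
    ∑ i ∈ s, p i * (1 - p i) *
      pbMean p (s.erase i) (fun r => if q r ∧ ¬ q (r + 1) then 1 else 0) ≤ σ / 2 := by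
  -- This test function is `1/2` in absolute value and jumps by `1` exactly at the cut of `q`; the
  -- Stein identity then bounds the sum by `E|R - ER| / 2`.
  have h := sub_mean_mul (p := p) (s := s) (fun r => if q r then -(1 / 2 : ℝ) else 1 / 2)
  have h2 : (fun r : ℕ =>
        (if q (r + 1) then -(1 / 2 : ℝ) else 1 / 2) - if q r then -(1 / 2 : ℝ) else 1 / 2)
      = fun r => if q r ∧ ¬ q (r + 1) then 1 else 0 := by
    ext r
    have := hq r
    by_cases h1 : q r <;> by_cases h2 : q (r + 1) <;> simp_all
    norm_num
  rw [h2] at h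
  rw [← h]
  have h3 : pbMean p s (fun r => ((r : ℝ) - ∑ i ∈ s, p i) * (if q r then -(1 / 2 : ℝ) else 1 / 2))
      ≤ pbMean p s (fun r => (1 / 2) * |(r : ℝ) - ∑ i ∈ s, p i|) := by
    refine mono hp0 hp1 fun r => ?_
    split_ifs
    · linarith [neg_abs_le ((r : ℝ) - ∑ i ∈ s, p i)]
    · linarith [le_abs_self ((r : ℝ) - ∑ i ∈ s, p i)]
  rw [const_mul] at h3
  linarith [abs_sub_mean_le hp0 hp1 hσ hv]

end pbMean

/-! ### Tails of the normal distribution -/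

/-- The density of the standard normal distribution. -/
noncomputable abbrev stdPDF : ℝ → ℝ := gaussianPDFReal 0 1

/-- The distribution function of the standard normal distribution. -/
noncomputable abbrev stdCDF (x : ℝ) : ℝ := cdf (gaussianReal 0 1) x

theorem stdPDF_eq (x : ℝ) : stdPDF x = (√(2 * Real.pi))⁻¹ * Real.exp (-x ^ 2 / 2) := by
  simp [stdPDF, gaussianPDFReal]

theorem stdPDF_pos (x : ℝ) : 0 < stdPDF x := gaussianPDFReal_pos 0 1 x one_ne_zero

theorem hasDerivAt_stdPDF (x : ℝ) : HasDerivAt stdPDF (-x * stdPDF x) x := by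
  have h : stdPDF = fun x => (√(2 * Real.pi))⁻¹ * Real.exp (-x ^ 2 / 2) := funext stdPDF_eq
  have h1 : HasDerivAt (fun x : ℝ => -x ^ 2 / 2) (-x) x := by
    have := ((hasDerivAt_pow 2 x).neg).div_const 2
    refine this.congr_deriv ?_
    push_cast
    ring
  rw [h]
  refine (h1.exp.const_mul _).congr_deriv ?_
  ring

theorem continuous_stdPDF : Continuous stdPDF :=
  continuous_iff_continuousAt.2 fun x => (hasDerivAt_stdPDF x).continuousAt

theorem stdPDF_neg (x : ℝ) : stdPDF (-x) = stdPDF x := by simp [stdPDF_eq]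

theorem stdPDF_anti {x y : ℝ} (h : |x| ≤ |y|) : stdPDF y ≤ stdPDF x := by
  rw [stdPDF_eq, stdPDF_eq]
  have := sq_le_sq.2 h
  gcongr

theorem stdPDF_le_one (x : ℝ) : stdPDF x ≤ 1 := by
  rw [stdPDF_eq]
  have h1 : 1 ≤ √(2 * Real.pi) := by
    rw [Real.one_le_sqrt]
    linarith [Real.pi_gt_three]
  have h2 : Real.exp (-x ^ 2 / 2) ≤ 1 := Real.exp_le_one_iff.2 (by nlinarith [sq_nonneg x])
  have h3 : (√(2 * Real.pi))⁻¹ ≤ 1 := inv_le_one_of_one_le₀ h1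
  calc _ ≤ 1 * (1 : ℝ) := by gcongr
    _ = 1 := one_mul 1

theorem stdCDF_eq_integral (x : ℝ) : stdCDF x = ∫ y in Set.Iic x, stdPDF y := by
  rw [stdCDF, cdf_eq_real, measureReal_def, gaussianReal_apply_eq_integral 0 one_ne_zero,
    ENNReal.toReal_ofReal]
  exact integral_nonneg fun y => (stdPDF_pos y).le

theorem hasDerivAt_stdCDF (x : ℝ) : HasDerivAt stdCDF (stdPDF x) x := by
  have hi : Integrable stdPDF := integrable_gaussianPDFReal 0 1
  have h : stdCDF = fun y => stdCDF 0 + ∫ t in (0 : ℝ)..y, stdPDF t := by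
    ext y
    rw [intervalIntegral.integral_Iic_sub_Iic hi.integrableOn hi.integrableOn |>.symm,
      stdCDF_eq_integral, stdCDF_eq_integral]
    ring
  rw [h]
  exact (intervalIntegral.integral_hasDerivAt_right (continuous_stdPDF.intervalIntegrable 0 x)
    (continuous_stdPDF.stronglyMeasurableAtFilter _ _) continuous_stdPDF.continuousAt).const_add _

theorem continuous_stdCDF : Continuous stdCDF :=
  continuous_iff_continuousAt.2 fun x => (hasDerivAt_stdCDF x).continuousAt

theorem stdCDF_neg (x : ℝ) : stdCDF (-x) = 1 - stdCDF x := by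
  have h1 : gaussianReal 0 1 = (gaussianReal 0 1).map (fun x : ℝ => -x) := by
    rw [gaussianReal_map_neg, neg_zero]
  have h2 : stdCDF (-x) = (gaussianReal 0 1).real (Set.Ici x) := by
    rw [stdCDF, cdf_eq_real]
    conv_lhs => rw [h1]
    rw [map_measureReal_apply measurable_neg measurableSet_Iic]
    congr 1
    ext y
    simp
  have h3 : (gaussianReal 0 1).real (Set.Ici x) = (gaussianReal 0 1).real (Set.Ioi x) := by
    have := nullSingletonClass_gaussianReal (μ := 0) (v := 1) one_ne_zero
    exact measureReal_congr Ioi_ae_eq_Ici.symm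
  rw [h2, h3, stdCDF, cdf_eq_real, ← Set.compl_Iic, probReal_compl_eq_one_sub measurableSet_Iic]

/-- Mills' ratio: `φ(y)/y - (1 - Φ(y))` has derivative `-φ(y)/y²` and tends to `0`, hence is
nonnegative. -/
theorem mul_one_sub_stdCDF_le {x : ℝ} (hx : 0 < x) : x * (1 - stdCDF x) ≤ stdPDF x := by
  have hd : ∀ y ∈ Set.Ici x, HasDerivAt (fun y => stdPDF y / y - (1 - stdCDF y))
      (-(stdPDF y / y ^ 2)) y := by
    intro y hy
    have hy0 : y ≠ 0 := (hx.trans_le hy).ne'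
    refine (((hasDerivAt_stdPDF y).div (hasDerivAt_id y) hy0).sub
      ((hasDerivAt_stdCDF y).const_sub 1)).congr_deriv ?_
    simp only [id]
    field_simp
    ring
  have hanti : AntitoneOn (fun y => stdPDF y / y - (1 - stdCDF y)) (Set.Ici x) := by
    refine antitoneOn_of_deriv_nonpos (convex_Ici x)
      (fun y hy => (hd y hy).continuousAt.continuousWithinAt)
      (fun y hy => (hd y (interior_subset hy)).differentiableAt.differentiableWithinAt)
      fun y hy => ?_
    rw [(hd y (interior_subset hy)).deriv]
    have := (stdPDF_pos y).le
    have : 0 ≤ stdPDF y / y ^ 2 := by positivity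
    linarith
  have hlim : Tendsto (fun y => stdPDF y / y - (1 - stdCDF y)) atTop (nhds 0) := by
    have h1 : Tendsto (fun y => stdPDF y / y) atTop (nhds 0) := by
      refine squeeze_zero' ?_ ?_ tendsto_inv_atTop_zero
      · filter_upwards [eventually_gt_atTop 0] with y hy
        exact (div_pos (stdPDF_pos y) hy).le
      · filter_upwards [eventually_gt_atTop 0] with y hy
        rw [div_eq_mul_inv]
        exact mul_le_of_le_one_left (inv_pos.2 hy).le (stdPDF_le_one y)
    simpa using h1.sub ((tendsto_cdf_atTop (gaussianReal 0 1)).const_sub 1)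
  have h0 : 0 ≤ stdPDF x / x - (1 - stdCDF x) := by
    refine le_of_tendsto hlim ?_
    filter_upwards [eventually_ge_atTop x] with y hy
    exact hanti Set.self_mem_Ici hy hy
  have h1 : 1 - stdCDF x ≤ stdPDF x / x := by linarith
  rw [le_div_iff₀ hx] at h1
  linarith

theorem one_sub_stdCDF_le {x : ℝ} (hx : 0 ≤ x) : 1 - stdCDF x ≤ 5 * stdPDF x := by
  rcases le_total 1 x with h1 | h1
  · have h2 := mul_one_sub_stdCDF_le (zero_lt_one.trans_le h1)
    have h3 := stdPDF_pos x
    have h4 : 0 ≤ 1 - stdCDF x := sub_nonneg.2 (cdf_le_one _ x)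
    nlinarith
  · have h2 : stdPDF 1 ≤ stdPDF x := stdPDF_anti (by rwa [abs_of_nonneg hx, abs_one])
    have h3 : 1 ≤ 5 * stdPDF 1 := by
      rw [stdPDF_eq, ← mul_assoc, ← div_eq_mul_inv]
      have h4 : √(2 * Real.pi) ≤ 2.52 := by
        rw [Real.sqrt_le_left (by norm_num)]
        linarith [Real.pi_lt_d2]
      have h5 : Real.exp (1 / 2) ≤ 1.65 := by
        have h6 : Real.exp (1 / 2) ^ 2 = Real.exp 1 := by
          rw [← Real.exp_nat_mul]
          norm_num
        have := Real.exp_one_lt_d9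
        refine le_of_sq_le_sq ?_ (by norm_num)
        rw [h6]
        norm_num at this ⊢
        linarith
      have h6 : Real.exp (-1 ^ 2 / 2) = (Real.exp (1 / 2))⁻¹ := by
        rw [← Real.exp_neg]
        norm_num
      rw [h6, ← div_eq_mul_inv, div_div, le_div_iff₀ (by positivity)]
      calc _ ≤ 1 * (2.52 * 1.65 : ℝ) := by gcongr
        _ ≤ 5 := by norm_num
    have h4 : 0 ≤ stdCDF x := cdf_nonneg _ x
    linarith

theorem stdCDF_le_of_nonpos {x : ℝ} (hx : x ≤ 0) : stdCDF x ≤ 5 * stdPDF x := by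
  have h := one_sub_stdCDF_le (neg_nonneg.2 hx)
  rw [stdCDF_neg, stdPDF_neg] at h
  linarith

theorem neg_mul_stdCDF_le {x : ℝ} (hx : x < 0) : -x * stdCDF x ≤ stdPDF x := by
  have h := mul_one_sub_stdCDF_le (neg_pos.2 hx)
  rw [stdCDF_neg, stdPDF_neg] at h
  linarith

/-! ### The Stein equation -/

/-- The bounded solution `f` of the Stein equation `f' w - w * f w = 1_{w ≤ z} - Φ z`. -/
noncomputable def steinSol (z w : ℝ) : ℝ :=
  (stdCDF (min w z) - stdCDF w * stdCDF z) / stdPDF w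

/-- The derivative of `steinSol z`, left-continuous at `z`. -/
noncomputable def steinDeriv (z w : ℝ) : ℝ :=
  w * steinSol z w + (if w ≤ z then 1 else 0) - stdCDF z

namespace steinSol

variable (z w : ℝ)

theorem numerator_nonneg : 0 ≤ stdCDF (min w z) - stdCDF w * stdCDF z := by
  have h1 := cdf_le_one (gaussianReal 0 1) z
  have h2 := cdf_nonneg (gaussianReal 0 1) z
  have h3 := cdf_le_one (gaussianReal 0 1) w
  have h4 := cdf_nonneg (gaussianReal 0 1) w
  rcases le_total w z with h | h
  · rw [min_eq_left h]; simp only [stdCDF]; nlinarith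
  · rw [min_eq_right h]; simp only [stdCDF]; nlinarith

theorem numerator_le_left : stdCDF (min w z) - stdCDF w * stdCDF z ≤ stdCDF w := by
  have h2 := cdf_nonneg (gaussianReal 0 1) z
  have h4 := cdf_nonneg (gaussianReal 0 1) w
  have := monotone_cdf (gaussianReal 0 1) (min_le_left w z)
  simp only [stdCDF]; nlinarith

theorem numerator_le_right : stdCDF (min w z) - stdCDF w * stdCDF z ≤ 1 - stdCDF w := by
  have h1 := cdf_le_one (gaussianReal 0 1) z
  have h3 := cdf_le_one (gaussianReal 0 1) w
  have := monotone_cdf (gaussianReal 0 1) (min_le_right w z)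
  simp only [stdCDF] at *; nlinarith

theorem nonneg : 0 ≤ steinSol z w := div_nonneg (numerator_nonneg z w) (stdPDF_pos w).le

theorem le_five : steinSol z w ≤ 5 := by
  rw [steinSol, div_le_iff₀ (stdPDF_pos w)]
  rcases le_total 0 w with h | h
  · exact (numerator_le_right z w).trans (one_sub_stdCDF_le h)
  · exact (numerator_le_left z w).trans (stdCDF_le_of_nonpos h)

theorem abs_le_five : |steinSol z w| ≤ 5 := by
  rw [abs_of_nonneg (nonneg z w)]
  exact le_five z w

/-- For `w < 0` the numerator is at most `Φ(w)`, for `w > 0` at most `1 - Φ(w)`; Mills' ratio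
absorbs the factor `|w|` in both cases. -/
theorem abs_mul_le_one : |w * steinSol z w| ≤ 1 := by
  rw [abs_mul, abs_of_nonneg (nonneg z w), steinSol, ← mul_div_assoc, div_le_one (stdPDF_pos w)]
  rcases lt_trichotomy w 0 with h | h | h
  · rw [abs_of_neg h]
    exact (mul_le_mul_of_nonneg_left (numerator_le_left z w) (by linarith)).trans
      (neg_mul_stdCDF_le h)
  · rw [h, abs_zero, zero_mul]
    exact (stdPDF_pos 0).le
  · rw [abs_of_pos h]
    exact (mul_le_mul_of_nonneg_left (numerator_le_right z w) h.le).trans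
      (mul_one_sub_stdCDF_le h)

theorem abs_steinDeriv_le : |steinDeriv z w| ≤ 2 := by
  have h1 := abs_le.1 (abs_mul_le_one z w)
  have h2 := cdf_le_one (gaussianReal 0 1) z
  have h3 := cdf_nonneg (gaussianReal 0 1) z
  rw [steinDeriv, abs_le]
  split_ifs <;> constructor <;> simp only [stdCDF] <;> linarith

theorem continuous : Continuous (steinSol z) := by
  unfold steinSol
  refine Continuous.div ?_ continuous_stdPDF fun w => (stdPDF_pos w).ne'
  exact (continuous_stdCDF.comp (continuous_id.min continuous_const)).sub
    (continuous_stdCDF.mul continuous_const)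

theorem hasDerivAt {z w : ℝ} (h : w ≠ z) : HasDerivAt (steinSol z) (steinDeriv z w) w := by
  have hp := (stdPDF_pos w).ne'
  have hmin : HasDerivAt (fun w => stdCDF (min w z)) ((if w ≤ z then 1 else 0) * stdPDF w) w := by
    rcases lt_or_gt_of_ne h with h1 | h1
    · rw [if_pos h1.le, one_mul]
      refine (hasDerivAt_stdCDF w).congr_of_eventuallyEq ?_
      filter_upwards [Iio_mem_nhds h1] with y hy
      rw [min_eq_left (le_of_lt hy)]
    · rw [if_neg h1.not_ge, zero_mul]
      refine (hasDerivAt_const w (stdCDF z)).congr_of_eventuallyEq ?_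
      filter_upwards [Ioi_mem_nhds h1] with y hy
      rw [min_eq_right (le_of_lt hy)]
  refine ((hmin.sub ((hasDerivAt_stdCDF w).mul_const _)).div (hasDerivAt_stdPDF w) hp).congr_deriv ?_
  simp only [steinDeriv, steinSol, Pi.sub_apply]
  field_simp
  ring

/-- The only kink is at `z`; it may be an endpoint, where the mean value theorem asks just for
continuity. -/
theorem exists_slope {a b : ℝ} (hab : a < b) (h : z ∉ Set.Ioo a b) :
    ∃ c ∈ Set.Ioo a b, steinSol z b - steinSol z a = (b - a) * steinDeriv z c := by
  obtain ⟨c, hc, h⟩ := exists_hasDerivAt_eq_slope (steinSol z) (steinDeriv z) hab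
    (continuous z).continuousOn fun x hx => hasDerivAt (fun hxz => h (hxz ▸ hx))
  refine ⟨c, hc, ?_⟩
  rw [h, mul_div_cancel₀ _ (sub_pos.2 hab).ne']

theorem abs_sub_le {a b : ℝ} (hab : a ≤ b) : |steinSol z b - steinSol z a| ≤ 2 * (b - a) := by
  have key : ∀ {a b : ℝ}, a ≤ b → z ∉ Set.Ioo a b → |steinSol z b - steinSol z a| ≤ 2 * (b - a) := by
    intro a b hab hz
    rcases hab.eq_or_lt with rfl | hab
    · simp
    · obtain ⟨c, -, h⟩ := exists_slope z hab hz
      rw [h, abs_mul, abs_of_pos (sub_pos.2 hab), mul_comm]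
      exact mul_le_mul_of_nonneg_right (abs_steinDeriv_le z c) (sub_pos.2 hab).le
  by_cases hz : z ∈ Set.Ioo a b
  · have h1 := abs_le.1 (key hz.1.le (fun h => lt_irrefl _ h.2))
    have h2 := abs_le.1 (key hz.2.le (fun h => lt_irrefl _ h.1))
    rw [abs_le]
    constructor <;> linarith [h1.1, h1.2, h2.1, h2.2]
  · exact key hab hz

theorem abs_mul_sub_mul_le {h c v : ℝ} (hc : |c - v| ≤ h) :
    |c * steinSol z c - v * steinSol z v| ≤ h * (5 + 2 * |v|) := by
  have h0 : 0 ≤ h := (abs_nonneg _).trans hc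
  have h1 : |steinSol z c - steinSol z v| ≤ 2 * h := by
    rcases le_total v c with hvc | hvc
    · have := abs_sub_le z hvc
      linarith [le_abs_self (c - v)]
    · rw [abs_sub_comm]
      have := abs_sub_le z hvc
      linarith [neg_abs_le (c - v)]
  have h2 : c * steinSol z c - v * steinSol z v
      = (c - v) * steinSol z c + v * (steinSol z c - steinSol z v) := by ring
  rw [h2]
  refine (abs_add_le _ _).trans ?_
  rw [abs_mul, abs_mul]
  calc _ ≤ h * 5 + |v| * (2 * h) := by
        gcongr
        exact abs_le_five z c
    _ = _ := by ring

theorem abs_slope_sub_le {h v : ℝ} (hh : 0 < h) (hv : v ∈ Set.Icc w (w + h)) :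
    |h * steinDeriv z v - (steinSol z (w + h) - steinSol z w)|
      ≤ h * (4 * (if w ≤ z ∧ ¬ (w + h ≤ z) then 1 else 0) + h * (5 + 2 * (|w| + h))) := by
  have hvw : |v| ≤ |w| + h := by
    have h1 : |v - w| ≤ h := abs_le.2 ⟨by linarith [hv.1], by linarith [hv.2]⟩
    have h2 := abs_add_le w (v - w)
    rw [add_sub_cancel] at h2
    linarith
  -- If the step crosses `z`, the bounds `|f'| ≤ 2` and Lipschitz constant `2` give `4h`. Otherwise
  -- the indicator in `f'` is constant on the points compared, and only the variation of `w * f w`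
  -- remains. The case `z = w` counts as a crossing, in line with the left-continuous choice of
  -- `f'`.
  by_cases hz : w ≤ z ∧ ¬ (w + h ≤ z)
  · rw [if_pos hz]
    have h1 := abs_le.1 (abs_sub_le z (le_add_of_nonneg_right hh.le : w ≤ w + h))
    have h2 := abs_le.1 (abs_steinDeriv_le z v)
    have h3 : 0 ≤ h * (h * (5 + 2 * (|w| + h))) := by positivity
    rw [abs_le]
    constructor <;> nlinarith [h1.1, h1.2, h2.1, h2.2]
  · rw [if_neg hz]
    have hz1 : z < w ∨ w + h ≤ z := by
      by_contra hcon
      push Not at hcon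
      exact hz ⟨hcon.1, hcon.2.not_ge⟩
    obtain ⟨c, hc, hs⟩ := exists_slope z (lt_add_of_pos_right w hh)
      (fun hm => hz1.elim (fun h1 => h1.not_gt hm.1) fun h1 => h1.not_gt hm.2)
    have hind : (if v ≤ z then (1 : ℝ) else 0) = if c ≤ z then 1 else 0 := by
      rcases hz1 with h1 | h1
      · rw [if_neg (h1.trans_le hv.1).not_ge, if_neg (h1.trans hc.1).not_ge]
      · rw [if_pos (hv.2.trans h1), if_pos (hc.2.le.trans h1)]
    rw [hs, add_sub_cancel_left, ← mul_sub, abs_mul, abs_of_pos hh, mul_zero, zero_add]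
    refine mul_le_mul_of_nonneg_left ?_ hh.le
    rw [steinDeriv, steinDeriv, hind, abs_sub_comm]
    have h1 : |c - v| ≤ h :=
      abs_le.2 ⟨by linarith [hv.2, hc.1], by linarith [hv.1, hc.2]⟩
    have h2 := abs_mul_sub_mul_le z h1
    calc _ = |c * steinSol z c - v * steinSol z v| := by congr 1; ring
      _ ≤ _ := h2.trans (by gcongr)

end steinSol

/-! ### The Berry–Esseen bound -/

namespace pbMean

variable {ι : Type*} [DecidableEq ι] {p : ι → ℝ} {s : Finset ι}

/-- The contribution of one trial to the difference of the two sides of the Stein identity. -/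
theorem abs_stein_term_le (hp0 : ∀ i, 0 ≤ p i) (hp1 : ∀ i, p i ≤ 1) {h : ℝ} (hh : 0 < h) (z : ℝ)
    {w : ℕ → ℝ} (hw : ∀ r, w (r + 1) = w r + h) {i : ι} (hi : i ∈ s)
    (hm : pbMean p s (fun r => |w r|) ≤ 1) :
    |h * pbMean p s (fun r => steinDeriv z (w r))
        - pbMean p (s.erase i) (fun r => steinSol z (w (r + 1)) - steinSol z (w r))|
      ≤ h * (4 * pbMean p (s.erase i) (fun r => if w r ≤ z ∧ ¬ w (r + 1) ≤ z then 1 else 0)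
        + h * (7 + 4 * h)) := by
  set q : ℕ → ℝ := fun r => if w r ≤ z ∧ ¬ w (r + 1) ≤ z then 1 else 0 with hq
  -- Conditioning on trial `i` makes both terms expectations over the other trials.
  have h1 : h * pbMean p s (fun r => steinDeriv z (w r))
        - pbMean p (s.erase i) (fun r => steinSol z (w (r + 1)) - steinSol z (w r))
      = pbMean p (s.erase i) (fun r =>
          p i * (h * steinDeriv z (w (r + 1)) - (steinSol z (w (r + 1)) - steinSol z (w r)))
          + (1 - p i) * (h * steinDeriv z (w r) - (steinSol z (w (r + 1)) - steinSol z (w r)))) := by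
    rw [erase hi, add, const_mul, const_mul, sub _ (fun r => steinSol z (w (r + 1)) - _),
      sub _ (fun r => steinSol z (w (r + 1)) - _), const_mul, const_mul]
    ring
  have h2 : ∀ r, |p i * (h * steinDeriv z (w (r + 1)) - (steinSol z (w (r + 1)) - steinSol z (w r)))
          + (1 - p i) * (h * steinDeriv z (w r) - (steinSol z (w (r + 1)) - steinSol z (w r)))|
        ≤ h * (4 * q r + h * (5 + 2 * (|w r| + h))) := by
    intro r
    have ha := steinSol.abs_slope_sub_le z (w r) (v := w r + h) hh ⟨by linarith, le_rfl⟩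
    have hb := steinSol.abs_slope_sub_le z (w r) (v := w r) hh ⟨le_rfl, by linarith⟩
    rw [← hw] at ha hb
    refine (abs_add_le _ _).trans ?_
    rw [abs_mul, abs_mul, abs_of_nonneg (hp0 i), abs_of_nonneg (sub_nonneg.2 (hp1 i))]
    calc _ ≤ p i * (h * (4 * q r + h * (5 + 2 * (|w r| + h))))
          + (1 - p i) * (h * (4 * q r + h * (5 + 2 * (|w r| + h)))) :=
          add_le_add (mul_le_mul_of_nonneg_left ha (hp0 i))
            (mul_le_mul_of_nonneg_left hb (sub_nonneg.2 (hp1 i)))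
      _ = _ := by ring
  -- Dropping one trial moves `w` by at most `h`. With this bound `5 + 2(|w| + h)` has mean at most
  -- `7 + 4h`.
  have h3 : pbMean p (s.erase i) (fun r => |w r|) ≤ 1 + h := by
    have hr : ∀ r, |w r| ≤ p i * (|w (r + 1)| + h) + (1 - p i) * (|w r| + h) := by
      intro r
      have : |w r| ≤ |w (r + 1)| + h := by
        have := abs_sub (w (r + 1)) h
        rwa [hw, add_sub_cancel_right, abs_of_pos hh, ← hw] at this
      nlinarith [hp0 i, hp1 i]
    refine (mono hp0 hp1 hr).trans ?_
    rw [add, const_mul, const_mul, add, add, const]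
    rw [erase hi] at hm
    linarith
  rw [h1]
  refine (abs_le hp0 hp1 h2).trans ?_
  have h4 : (fun r => h * (4 * q r + h * (5 + 2 * (|w r| + h))))
      = fun r => h * (4 * q r) + (2 * h ^ 2 * |w r| + h ^ 2 * (5 + 2 * h)) := by
    ext r; ring
  rw [h4, add, const_mul, const_mul, add, const_mul, const]
  nlinarith [sq_nonneg h]

/-- The Berry–Esseen theorem for sums of independent indicators. -/
theorem berryEsseen (hp0 : ∀ i, 0 ≤ p i) (hp1 : ∀ i, p i ≤ 1) {σ : ℝ} (hσ : 1 ≤ σ)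
    (hv : ∑ i ∈ s, p i * (1 - p i) = σ ^ 2) (z : ℝ) :
    |pbMean p s (fun r => if ((r : ℝ) - ∑ i ∈ s, p i) / σ ≤ z then 1 else 0) - stdCDF z|
      ≤ 13 / σ := by
  have hσ0 : 0 < σ := by linarith
  set w : ℕ → ℝ := fun r => ((r : ℝ) - ∑ i ∈ s, p i) / σ with hwdef
  set h : ℝ := 1 / σ with hh
  have hh0 : 0 < h := by positivity
  have hh1 : h ≤ 1 := by rw [hh, div_le_one hσ0]; exact hσ
  have hw : ∀ r, w (r + 1) = w r + h := by
    intro r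
    simp only [hwdef, hh]
    push_cast
    ring
  have hm : pbMean p s (fun r => |w r|) ≤ 1 := by
    have : (fun r => |w r|) = fun r : ℕ => h * |(r : ℝ) - ∑ i ∈ s, p i| := by
      ext r
      simp only [hwdef, hh, abs_div, abs_of_pos hσ0]
      ring
    rw [this, const_mul]
    calc _ ≤ h * σ := mul_le_mul_of_nonneg_left (abs_sub_mean_le hp0 hp1 hσ0 hv) hh0.le
      _ = 1 := by rw [hh]; field_simp
  have hstein : pbMean p s (fun r => if w r ≤ z then 1 else 0) - stdCDF z
      = pbMean p s (fun r => steinDeriv z (w r)) - pbMean p s (fun r => w r * steinSol z (w r)) := by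
    rw [← sub, ← const (p := p) (s := s) (stdCDF z), ← sub]
    congr 1
    ext r
    simp only [steinDeriv]
    ring
  have hW : pbMean p s (fun r => w r * steinSol z (w r))
      = h * ∑ i ∈ s, p i * (1 - p i) *
        pbMean p (s.erase i) (fun r => steinSol z (w (r + 1)) - steinSol z (w r)) := by
    rw [← sub_mean_mul (fun r => steinSol z (w r)), ← const_mul]
    congr 1
    ext r
    simp only [hwdef, hh]
    ring
  -- The weights `h² p i (1 - p i)` sum to `1`, so the mean of `f'` can be spread over the trials
  -- and compared term by term.
  have hD : pbMean p s (fun r => steinDeriv z (w r))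
      = h * ∑ i ∈ s, p i * (1 - p i) * (h * pbMean p s (fun r => steinDeriv z (w r))) := by
    rw [← Finset.sum_mul, hv, hh]
    field_simp
  rw [hstein, hD, hW, ← mul_sub, ← Finset.sum_sub_distrib, abs_mul, abs_of_pos hh0]
  have hconc := concentration hp0 hp1 hσ0 hv (fun r => w r ≤ z)
    fun r hr => by rw [hw] at hr; linarith
  have hsum : |∑ i ∈ s, (p i * (1 - p i) * (h * pbMean p s (fun r => steinDeriv z (w r)))
        - p i * (1 - p i) *
          pbMean p (s.erase i) (fun r => steinSol z (w (r + 1)) - steinSol z (w r)))| ≤ 13 := by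
    refine (Finset.abs_sum_le_sum_abs _ _).trans ?_
    have hterm : ∀ i ∈ s, |p i * (1 - p i) * (h * pbMean p s (fun r => steinDeriv z (w r)))
        - p i * (1 - p i) *
          pbMean p (s.erase i) (fun r => steinSol z (w (r + 1)) - steinSol z (w r))|
        ≤ (4 * h) * (p i * (1 - p i) * pbMean p (s.erase i)
            (fun r => if w r ≤ z ∧ ¬ w (r + 1) ≤ z then 1 else 0))
          + (p i * (1 - p i)) * (h ^ 2 * (7 + 4 * h)) := by
      intro i hi
      have hpq : 0 ≤ p i * (1 - p i) := mul_nonneg (hp0 i) (sub_nonneg.2 (hp1 i))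
      rw [← mul_sub, abs_mul, abs_of_nonneg hpq]
      refine (mul_le_mul_of_nonneg_left
        (abs_stein_term_le hp0 hp1 hh0 z hw hi hm) hpq).trans (le_of_eq ?_)
      ring
    refine (Finset.sum_le_sum hterm).trans ?_
    rw [Finset.sum_add_distrib, ← Finset.mul_sum, ← Finset.sum_mul, hv]
    have hhσ : h * σ = 1 := by rw [hh]; field_simp
    have e1 : σ ^ 2 * (h ^ 2 * (7 + 4 * h)) = (h * σ) ^ 2 * (7 + 4 * h) := by ring
    rw [e1, hhσ]
    -- Concentration contributes `4h · σ/2 = 2` and smoothness `7 + 4h ≤ 11`, in total `13`.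
    nlinarith [mul_le_mul_of_nonneg_left hconc hh0.le]
  calc _ ≤ h * 13 := mul_le_mul_of_nonneg_left hsum hh0.le
    _ = 13 / σ := by rw [hh]; ring

end pbMean

/-! ### Records of a random permutation -/

/-- The number of right-to-left maxima of a permutation. -/
def Equiv.Perm.numRecords {n : ℕ} (π : Equiv.Perm (Fin n)) : ℕ :=
  (Finset.univ.filter fun a => ∀ b, a < b → π b < π a).card

/-- The permutation with value `p` at `0` whose other values are in the same relative order
as those of `e`. -/
def Equiv.Perm.consPerm {n : ℕ} (p : Fin (n + 1)) (e : Equiv.Perm (Fin n)) :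
    Equiv.Perm (Fin (n + 1)) :=
  (finSuccEquiv n).trans ((Equiv.optionCongr e).trans (finSuccEquiv' p).symm)

namespace Equiv.Perm

variable {n : ℕ}

theorem consPerm_zero (p : Fin (n + 1)) (e : Equiv.Perm (Fin n)) : consPerm p e 0 = p := by
  simp [consPerm]

theorem consPerm_succ (p : Fin (n + 1)) (e : Equiv.Perm (Fin n)) (i : Fin n) :
    consPerm p e i.succ = p.succAbove (e i) := by
  simp [consPerm]

theorem consPerm_bijective :
    Function.Bijective fun x : Fin (n + 1) × Equiv.Perm (Fin n) => consPerm x.1 x.2 := by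
  rw [Fintype.bijective_iff_injective_and_card]
  refine ⟨?_, by simp [Fintype.card_perm, Nat.factorial_succ]⟩
  rintro ⟨p, e⟩ ⟨q, f⟩ h
  simp only at h
  have hpq : p = q := by rw [← consPerm_zero p e, h, consPerm_zero]
  subst hpq
  refine Prod.ext rfl (Equiv.ext fun i => ?_)
  have := congrArg (fun π : Equiv.Perm (Fin (n + 1)) => π i.succ) h
  simpa [consPerm_succ] using this

/-- A new first entry leaves the later right-to-left maxima alone, and is one itself only if it
carries the largest value. -/
theorem numRecords_consPerm (p : Fin (n + 1)) (e : Equiv.Perm (Fin n)) :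
    (consPerm p e).numRecords = e.numRecords + if p = Fin.last n then 1 else 0 := by
  have h0 : (∀ b, 0 < b → consPerm p e b < consPerm p e 0) ↔ p = Fin.last n := by
    rw [consPerm_zero]
    constructor
    · intro h
      by_contra hp
      obtain ⟨i, hi⟩ := (consPerm p e).surjective (Fin.last n)
      have hi0 : i ≠ 0 := by
        rintro rfl
        exact hp (by rw [← hi, consPerm_zero])
      have := h i (Fin.pos_iff_ne_zero.2 hi0)
      rw [hi] at this
      exact this.not_ge (Fin.le_last p)
    · rintro rfl b hb
      refine lt_of_le_of_ne (Fin.le_last _) fun h => hb.ne' ((consPerm (Fin.last n) e).injective ?_)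
      rw [h, consPerm_zero]
  have hs : ∀ i : Fin n, (∀ b, i.succ < b → consPerm p e b < consPerm p e i.succ)
      ↔ ∀ b, i < b → e b < e i := by
    intro i
    constructor
    · intro h b hb
      have := h b.succ (Fin.succ_lt_succ_iff.2 hb)
      rwa [consPerm_succ, consPerm_succ, Fin.succAbove_lt_succAbove_iff] at this
    · intro h b hb
      obtain ⟨c, rfl⟩ := Fin.exists_succ_eq.2 ((Fin.zero_le _).trans_lt hb).ne'
      rw [consPerm_succ, consPerm_succ, Fin.succAbove_lt_succAbove_iff]
      exact h c (Fin.succ_lt_succ_iff.1 hb)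
  simp only [numRecords, Finset.card_filter, Fin.sum_univ_succ, h0, hs]
  rw [add_comm]

/-- The value at `0` is uniform and independent of the relative order of the rest, so passing from
`n` to `n + 1` adds an independent trial of probability `1/(n + 1)`. -/
theorem sum_numRecords (n : ℕ) (h : ℕ → ℝ) :
    ∑ π : Equiv.Perm (Fin n), h π.numRecords
      = n.factorial * pbMean (fun k : ℕ => 1 / ((k : ℝ) + 1)) (Finset.range n) h := by
  induction n generalizing h with
  | zero => simp [pbMean.empty, numRecords]
  | succ n ih =>
    rw [← Function.Bijective.sum_comp consPerm_bijective (fun π => h π.numRecords),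
      Fintype.sum_prod_type, Fin.sum_univ_castSucc, Finset.range_add_one,
      pbMean.insert Finset.notMem_range_self, Nat.factorial_succ]
    simp only [numRecords_consPerm, Fin.castSucc_ne_last, if_true, if_false, add_zero]
    rw [ih, ih (fun r => h (r + 1)), Finset.sum_const, Finset.card_univ, Fintype.card_fin]
    push_cast
    field_simp
    ring

end Equiv.Perm

/-! ### Elimination and undominated columns -/

namespace BimatrixGame

variable {m n : ℕ} (g : BimatrixGame m n)

open Classical in
/-- Column's actions that are not strictly dominated in the full game. -/
noncomputable def undominatedCols : Finset (Fin n) :=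
  Finset.univ.filter fun j => ¬ ∃ j', g.ColDominatedBy Finset.univ j j'

theorem RowDominatedBy.anti {g : BimatrixGame m n} {B B' : Finset (Fin n)} {i i' : Fin m}
    (h : g.RowDominatedBy B i i') (hB : B' ⊆ B) : g.RowDominatedBy B' i i' :=
  fun j hj => h j (hB hj)

theorem remaining_succ (k : ℕ) : g.remaining (k + 1) = g.eliminate (g.remaining k) :=
  Function.iterate_succ_apply' _ _ _

theorem survivingCols_subset : g.survivingCols ⊆ g.undominatedCols := by
  classical
  intro j hj
  have h := (Finset.mem_filter.1 hj).2 1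
  rw [remaining_succ] at h
  simpa [eliminate, remaining, undominatedCols] using h

/-- Row domination against all columns would imply it against the undominated ones, so the first
round deletes no row. The resulting subgame is a fixed point: all rows remain, so column domination
there is domination in the full game. -/
theorem survivingCols_eq (h : ¬ ∃ i i', g.RowDominatedBy g.undominatedCols i i') :
    g.survivingCols = g.undominatedCols := by
  classical
  have hrem : ∀ k, g.remaining (k + 1) = (Finset.univ, g.undominatedCols) := by
    intro k
    induction k with
    | zero =>
      rw [remaining_succ]
      refine Prod.ext ?_ ?_
      · refine Finset.filter_true_of_mem fun i _ => ?_
        rintro ⟨i', -, hi⟩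
        exact h ⟨i, i', hi.anti (Finset.subset_univ _)⟩
      · simp [eliminate, remaining, undominatedCols]
    | succ k ih =>
      rw [remaining_succ, ih]
      refine Prod.ext ?_ ?_
      · refine Finset.filter_true_of_mem fun i _ => ?_
        rintro ⟨i', -, hi⟩
        exact h ⟨i, i', hi⟩
      · refine Finset.filter_true_of_mem fun j hj => ?_
        rintro ⟨j', -, hj'⟩
        exact (Finset.mem_filter.1 hj).2 ⟨j', hj'⟩
  refine g.survivingCols_subset.antisymm fun j hj => Finset.mem_filter.2 ⟨Finset.mem_univ _, ?_⟩
  rintro (_ | k)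
  · simp [remaining]
  · rw [hrem]
    exact hj

end BimatrixGame

namespace RankingProfile

variable {m n : ℕ}

theorem rowDominatedBy_iff (ω : RankingProfile m n) (B : Finset (Fin n)) (i i' : Fin m) :
    ω.game.RowDominatedBy B i i' ↔ ∀ j ∈ B, ω.1 j i < ω.1 j i' := by
  simp [BimatrixGame.RowDominatedBy, game]

theorem colDominatedBy_iff (ω : RankingProfile m n) (A : Finset (Fin m)) (j j' : Fin n) :
    ω.game.ColDominatedBy A j j' ↔ ∀ i ∈ A, ω.2 i j < ω.2 i j' := by
  simp [BimatrixGame.ColDominatedBy, game]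

/-- Relabelling columns by `ω.2 0`, a column is undominated iff all columns to its right have a
smaller value of `ω.2 1`. -/
theorem card_undominatedCols (ω : RankingProfile 2 n) :
    ω.game.undominatedCols.card = (ω.2 1 * (ω.2 0)⁻¹).numRecords := by
  classical
  unfold BimatrixGame.undominatedCols Equiv.Perm.numRecords
  refine Finset.card_equiv (ω.2 0) fun j => ?_
  rw [Finset.mem_filter, Finset.mem_filter]
  simp only [Finset.mem_univ, true_and, colDominatedBy_iff, Fin.forall_fin_two,
    true_implies, not_exists, not_and, not_lt, Equiv.Perm.mul_apply]
  constructor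
  · intro h b hb
    have := h ((ω.2 0)⁻¹ b) (by simpa using hb)
    rw [show (ω.2 0)⁻¹ ((ω.2 0) j) = j from (ω.2 0).symm_apply_apply j]
    refine lt_of_le_of_ne this fun he => hb.ne ?_
    simpa using congrArg (ω.2 0) ((ω.2 1).injective he).symm
  · intro h j' hj'
    simpa using (h _ hj').le

end RankingProfile

/-! ### The cost of Row's eliminations -/

instance isProbabilityMeasure_randomGame (m n : ℕ) : IsProbabilityMeasure (randomGame m n) := by
  unfold randomGame
  infer_instance

theorem randomGame_real_singleton (m n : ℕ) (ω : RankingProfile m n) :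
    (randomGame m n).real {ω} = ((m.factorial : ℝ) ^ n * (n.factorial : ℝ) ^ m)⁻¹ := by
  obtain ⟨ρ, σ⟩ := ω
  rw [randomGame, ← Set.singleton_prod_singleton, measureReal_prod_prod, measureReal_def,
    measureReal_def, Measure.pi_singleton, Measure.pi_singleton]
  simp [uniformOn_univ, Fintype.card_perm, mul_comm]

theorem integral_randomGame (m n : ℕ) (f : RankingProfile m n → ℝ) :
    ∫ ω, f ω ∂(randomGame m n)
      = ((m.factorial : ℝ) ^ n * (n.factorial : ℝ) ^ m)⁻¹ * ∑ ρ, ∑ σ, f (ρ, σ) := by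
  rw [integral_fintype (Integrable.of_finite), ← Fintype.sum_prod_type, Finset.mul_sum]
  simp [randomGame_real_singleton]

namespace RankingProfile

variable {m n : ℕ}

/-- The number of Column's actions that are not strictly dominated in the full game. -/
noncomputable def numUndominated (ω : RankingProfile m n) : ℕ := ω.game.undominatedCols.card

theorem integral_numUndominated (n : ℕ) (h : ℕ → ℝ) :
    ∫ ω : RankingProfile 2 n, h ω.numUndominated ∂(randomGame 2 n)
      = pbMean (fun k : ℕ => 1 / ((k : ℝ) + 1)) (Finset.range n) h := by
  have h1 : ∑ σ : Fin 2 → Equiv.Perm (Fin n), h (σ 1 * (σ 0)⁻¹).numRecords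
      = n.factorial * ∑ π : Equiv.Perm (Fin n), h π.numRecords := by
    rw [← (finTwoArrowEquiv (Equiv.Perm (Fin n))).symm.sum_comp, Fintype.sum_prod_type]
    simp only [finTwoArrowEquiv_symm_apply, Matrix.cons_val_zero, Matrix.cons_val_one]
    -- For a fixed first ranking, right translation keeps the second one uniform.
    have h2 : ∀ a : Equiv.Perm (Fin n), ∑ b : Equiv.Perm (Fin n), h (b * a⁻¹).numRecords
        = ∑ π : Equiv.Perm (Fin n), h π.numRecords := fun a =>
      Equiv.sum_comp (Equiv.mulRight a⁻¹) fun π : Equiv.Perm (Fin n) => h π.numRecords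
    simp [h2, Fintype.card_perm]
  rw [integral_randomGame]
  simp only [numUndominated, card_undominatedCols]
  rw [h1, Finset.sum_const, Finset.card_univ, Fintype.card_fun, Fintype.card_perm,
    Equiv.Perm.sum_numRecords]
  have := Nat.factorial_ne_zero n
  simp only [Fintype.card_fin, nsmul_eq_mul]
  push_cast
  field_simp

/-- For nonempty `B` all rankings in `B` must agree on one of two orders, each having probability
`2^{-|B|}`. For empty `B` domination is vacuous and the bound exceeds the total count. -/
theorem card_rowDominated_le (B : Finset (Fin n)) :
    ((Finset.univ.filter fun ρ : Fin n → Equiv.Perm (Fin 2) =>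
      ∃ i i', ∀ j ∈ B, ρ j i < ρ j i').card : ℝ) ≤ 2 ^ n * (2 * (1 / 2) ^ B.card) := by
  rcases B.eq_empty_or_nonempty with rfl | ⟨j₀, hj₀⟩
  · have h : (Fintype.card (Fin n → Equiv.Perm (Fin 2)) : ℝ) = 2 ^ n := by
      simp [Fintype.card_perm]
    calc _ ≤ (2 : ℝ) ^ n := by
          rw [← h]
          exact_mod_cast Finset.card_le_univ _
      _ ≤ _ := by
          rw [Finset.card_empty, pow_zero]
          linarith [pow_pos (zero_lt_two' ℝ) n]
  · set F : Fin 2 → Fin 2 → Finset (Fin n → Equiv.Perm (Fin 2)) := fun i i' =>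
      Fintype.piFinset fun j => if j ∈ B then Finset.univ.filter fun τ => τ i < τ i' else Finset.univ
    have hF : ∀ i i', (Finset.univ.filter fun τ : Equiv.Perm (Fin 2) => τ i < τ i').card = 1 →
        ((F i i').card : ℝ) = 2 ^ n * (1 / 2) ^ B.card := by
      intro i i' h1
      rw [Fintype.card_piFinset]
      have h2 : ∀ j, ((if j ∈ B then Finset.univ.filter fun τ : Equiv.Perm (Fin 2) => τ i < τ i'
          else Finset.univ).card : ℝ) = 2 * if j ∈ B then 1 / 2 else 1 := by
        intro j
        split_ifs
        · rw [h1]; norm_num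
        · simp [Fintype.card_perm]
      push_cast
      simp_rw [h2]
      rw [Finset.prod_mul_distrib, Finset.prod_const, Finset.card_univ, Fintype.card_fin,
        Finset.prod_ite_mem, Finset.univ_inter, Finset.prod_const]
    have hsub : (Finset.univ.filter fun ρ : Fin n → Equiv.Perm (Fin 2) =>
        ∃ i i', ∀ j ∈ B, ρ j i < ρ j i') ⊆ F 0 1 ∪ F 1 0 := by
      intro ρ hρ
      obtain ⟨i, i', h⟩ := (Finset.mem_filter.1 hρ).2
      have hii : i ≠ i' := by
        rintro rfl
        exact lt_irrefl _ (h j₀ hj₀)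
      have hmem : ρ ∈ F i i' := by
        refine Fintype.mem_piFinset.2 fun j => ?_
        split_ifs with hj
        · simpa using h j hj
        · simp
      fin_cases i <;> fin_cases i'
      · exact absurd rfl hii
      · exact Finset.mem_union_left _ hmem
      · exact Finset.mem_union_right _ hmem
      · exact absurd rfl hii
    calc _ ≤ ((F 0 1 ∪ F 1 0).card : ℝ) := by exact_mod_cast Finset.card_le_card hsub
      _ ≤ (F 0 1).card + (F 1 0).card := by exact_mod_cast Finset.card_union_le _ _
      _ = _ := by
        rw [hF 0 1 (by decide), hF 1 0 (by decide)]
        ring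

/-- Replacing the number of surviving actions of Column by the number of actions that are
undominated in the full game changes expectations only by the effect of an unlikely event. -/
theorem integral_abs_sub_le (n : ℕ) (φ : ℝ → ℝ) (M : ℕ → ℝ)
    (hM : ∀ s r : ℕ, s ≤ r → |φ s - φ r| ≤ M r) :
    |∫ ω, φ (numSurvivingCols 2 n ω) ∂(randomGame 2 n)
        - pbMean (fun k : ℕ => 1 / ((k : ℝ) + 1)) (Finset.range n) (fun r => φ r)|
      ≤ pbMean (fun k : ℕ => 1 / ((k : ℝ) + 1)) (Finset.range n)
          (fun r => 2 * (1 / 2) ^ r * M r) := by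
  classical
  have hM0 : ∀ r, 0 ≤ M r := fun r => (abs_nonneg _).trans (hM r r le_rfl)
  rw [← integral_numUndominated, ← integral_numUndominated,
    ← integral_sub Integrable.of_finite Integrable.of_finite]
  refine (abs_integral_le_integral_abs).trans ?_
  rw [integral_randomGame, integral_randomGame]
  refine mul_le_mul_of_nonneg_left ?_ (by positivity)
  -- Column's rankings are fixed first: they alone determine the undominated set `B`, so the Row
  -- rankings in the definition of `B` are a dummy.
  rw [Finset.sum_comm, Finset.sum_comm (f := fun ρ σ => 2 * (1 / 2) ^ _ * _)]
  refine Finset.sum_le_sum fun σ _ => ?_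
  set B := (game ((fun _ => 1, σ) : RankingProfile 2 n)).undominatedCols with hB
  have hU : ∀ ρ, (game ((ρ, σ) : RankingProfile 2 n)).undominatedCols = B := fun _ => rfl
  have hle : ∀ ρ, |φ (numSurvivingCols 2 n (ρ, σ)) - φ (numUndominated (ρ, σ))|
      ≤ if ∃ i i', ∀ j ∈ B, ρ j i < ρ j i' then M B.card else 0 := by
    intro ρ
    simp only [numSurvivingCols, numUndominated, hU]
    split_ifs with h
    · refine hM _ _ ?_
      rw [← hU ρ]
      exact Finset.card_le_card (BimatrixGame.survivingCols_subset _)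
    · rw [BimatrixGame.survivingCols_eq _ (by simpa only [rowDominatedBy_iff, hU ρ] using h), hU,
        sub_self, abs_zero]
  refine (Finset.sum_le_sum fun ρ _ => hle ρ).trans ?_
  simp only [numUndominated, hU]
  rw [← Finset.sum_filter, Finset.sum_const, Finset.sum_const, nsmul_eq_mul, nsmul_eq_mul,
    Finset.card_univ, Fintype.card_fun, Fintype.card_perm, Fintype.card_fin, Fintype.card_fin]
  refine (mul_le_mul_of_nonneg_right (card_rowDominated_le B) (hM0 _)).trans (le_of_eq ?_)
  push_cast
  simp
  ring

end RankingProfile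

/-! ### Perturbation estimates -/

theorem abs_stdCDF_sub_le {a b c : ℝ} (h : ∀ t ∈ Set.uIcc a b, stdPDF t ≤ c) :
    |stdCDF b - stdCDF a| ≤ c * |b - a| :=
  (convex_uIcc a b).norm_image_sub_le_of_norm_hasDerivWithin_le
    (fun t _ => (hasDerivAt_stdCDF t).hasDerivWithinAt)
    (fun t ht => by rw [Real.norm_of_nonneg (stdPDF_pos t).le]; exact h t ht)
    Set.left_mem_uIcc Set.right_mem_uIcc

theorem abs_mul_stdPDF_le_one (t : ℝ) : |t| * stdPDF t ≤ 1 := by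
  have h1 : |t| ≤ Real.exp (t ^ 2 / 2) := by
    have h2 := Real.add_one_le_exp (t ^ 2 / 2)
    rw [← sq_abs] at h2 ⊢
    nlinarith [sq_nonneg (|t| - 1)]
  have h2 : stdPDF t ≤ (Real.exp (t ^ 2 / 2))⁻¹ := by
    rw [stdPDF_eq, ← Real.exp_neg, ← neg_div]
    refine mul_le_of_le_one_left (Real.exp_pos _).le (inv_le_one_of_one_le₀ ?_)
    rw [Real.one_le_sqrt]
    linarith [Real.pi_gt_three]
  calc _ ≤ Real.exp (t ^ 2 / 2) * (Real.exp (t ^ 2 / 2))⁻¹ :=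
        mul_le_mul h1 h2 (stdPDF_pos t).le (Real.exp_pos _).le
    _ = 1 := mul_inv_cancel₀ (Real.exp_pos _).ne'

/-- Between `x` and `α x` one has `|t| ≥ |x|/2`, so `|t| φ(t) ≤ 1` gives `φ(t) ≤ 2/|x|`. This
cancels the length `|α - 1| |x|`, making the bound uniform in `x`. -/
theorem abs_stdCDF_mul_sub_le {α : ℝ} (hα : 1 / 2 ≤ α) (x : ℝ) :
    |stdCDF (α * x) - stdCDF x| ≤ 2 * |α - 1| := by
  rcases eq_or_ne x 0 with rfl | hx
  · simp
  have hx0 := abs_pos.2 hx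
  have h : ∀ t ∈ Set.uIcc x (α * x), stdPDF t ≤ 2 / |x| := by
    intro t ht
    have h1 : |x| / 2 ≤ |t| := by
      rcases lt_or_gt_of_ne hx with h | h
      · have h2 : max x (α * x) ≤ x / 2 := max_le (by linarith) (by nlinarith)
        have h3 := ht.2.trans h2
        rw [abs_of_neg h, abs_of_neg (by linarith)]
        linarith
      · have h2 : x / 2 ≤ min x (α * x) := le_min (by linarith) (by nlinarith)
        have h3 := h2.trans ht.1
        rw [abs_of_pos h, abs_of_pos (by linarith)]
        linarith
    rw [le_div_iff₀ hx0]
    have := abs_mul_stdPDF_le_one t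
    nlinarith [stdPDF_pos t]
  refine (abs_stdCDF_sub_le h).trans (le_of_eq ?_)
  rw [← sub_one_mul, abs_mul]
  field_simp

theorem abs_stdCDF_affine_sub_le {α : ℝ} (hα : 1 / 2 ≤ α) (β x : ℝ) :
    |stdCDF (α * x + β) - stdCDF x| ≤ |β| + 2 * |α - 1| := by
  have h1 := abs_stdCDF_sub_le (a := α * x) (b := α * x + β) fun t _ => stdPDF_le_one t
  rw [add_sub_cancel_left, one_mul] at h1
  have h2 := abs_sub_le (stdCDF (α * x + β)) (stdCDF (α * x)) (stdCDF x)
  linarith [abs_stdCDF_mul_sub_le hα x]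

/-- The square root of a perturbation of a sequence that tends to infinity. -/
theorem sqrt_sub_isLittleO {V L : ℕ → ℝ} {c : ℝ} (hL : Tendsto L atTop atTop)
    (h : Tendsto (fun n => V n - L n) atTop (nhds c)) :
    (fun n => √(V n) - (√(L n) + c / (2 * √(L n)))) =o[atTop] fun n => 1 / √(L n) := by
  have hLpos := hL.eventually_gt_atTop 0
  refine (isLittleO_iff_tendsto' ?_).2 ?_
  · filter_upwards [hLpos] with n hn h0
    exact absurd h0 (by positivity)
  have h1 : Tendsto (fun n => V n / L n) atTop (nhds 1) := by
    have h2 : Tendsto (fun n => 1 + (V n - L n) / L n) atTop (nhds (1 + 0)) :=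
      (h.div_atTop hL).const_add 1
    rw [add_zero] at h2
    refine h2.congr' ?_
    filter_upwards [hLpos] with n hn
    field_simp
    ring
  -- This is the error multiplied by `√L`, since `√L (√V - √L) = (V - L) / (√(V/L) + 1)`.
  have h3 : Tendsto (fun n => (V n - L n) / (√(V n / L n) + 1) - c / 2) atTop (nhds 0) := by
    have h4 := (h.div (h1.sqrt.add_const 1) (by rw [Real.sqrt_one]; norm_num)).sub_const (c / 2)
    rw [Real.sqrt_one, show c / (1 + 1) - c / 2 = 0 by ring] at h4
    exact h4
  refine h3.congr' ?_
  filter_upwards [hLpos, h1.eventually (lt_mem_nhds zero_lt_one)] with n hn hV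
  have hVn : 0 < V n := by
    have := mul_pos hV hn
    rwa [div_mul_cancel₀ _ hn.ne'] at this
  rw [Real.sqrt_div hVn.le]
  have ha := Real.sqrt_pos.2 hVn
  have hb := Real.sqrt_pos.2 hn
  have ha2 : V n = √(V n) ^ 2 := (Real.sq_sqrt hVn.le).symm
  have hb2 : L n = √(L n) ^ 2 := (Real.sq_sqrt hn.le).symm
  have e : V n - L n = √(V n) ^ 2 - √(L n) ^ 2 := by rw [← ha2, ← hb2]
  rw [e]
  generalize √(V n) = a at *
  generalize √(L n) = b at *
  field_simp
  ring

/-! ### Mean and variance of the number of records -/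

/-- The success probabilities of the trials that decide which positions of a uniformly random
permutation are records. -/
noncomputable abbrev recordProb (k : ℕ) : ℝ := 1 / ((k : ℝ) + 1)

theorem recordProb_nonneg (k : ℕ) : 0 ≤ recordProb k := by
  unfold recordProb; positivity

theorem recordProb_le_one (k : ℕ) : recordProb k ≤ 1 := by
  unfold recordProb
  rw [div_le_one (by positivity)]
  linarith [Nat.cast_nonneg (α := ℝ) k]

/-- The expected number of records. -/
noncomputable def recordMean (n : ℕ) : ℝ := ∑ k ∈ Finset.range n, recordProb k

/-- The variance of the number of records. -/
noncomputable def recordVar (n : ℕ) : ℝ :=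
  ∑ k ∈ Finset.range n, recordProb k * (1 - recordProb k)

theorem recordMean_nonneg (n : ℕ) : 0 ≤ recordMean n :=
  Finset.sum_nonneg fun k _ => recordProb_nonneg k

theorem recordVar_nonneg (n : ℕ) : 0 ≤ recordVar n :=
  Finset.sum_nonneg fun k _ =>
    mul_nonneg (recordProb_nonneg k) (sub_nonneg.2 (recordProb_le_one k))

theorem recordVar_le_recordMean (n : ℕ) : recordVar n ≤ recordMean n :=
  Finset.sum_le_sum fun k _ => by nlinarith [recordProb_nonneg k]

theorem tendsto_recordMean_sub_log :
    Tendsto (fun n : ℕ => recordMean n - Real.log n) atTop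
      (nhds Real.eulerMascheroniConstant) := by
  refine Real.tendsto_harmonic_sub_log.congr fun n => ?_
  simp [recordMean, recordProb, harmonic]

theorem tendsto_natCast_log_atTop : Tendsto (fun n : ℕ => Real.log n) atTop atTop :=
  Real.tendsto_log_atTop.comp tendsto_natCast_atTop_atTop

theorem tendsto_recordVar_sub_log :
    Tendsto (fun n : ℕ => recordVar n - Real.log n) atTop
      (nhds (Real.eulerMascheroniConstant - Real.pi ^ 2 / 6)) := by
  have h1 : HasSum (fun k : ℕ => recordProb k ^ 2) (Real.pi ^ 2 / 6) := by
    have h2 := (hasSum_nat_add_iff' 1).2 hasSum_zeta_two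
    simpa [recordProb] using h2
  refine (tendsto_recordMean_sub_log.sub h1.tendsto_sum_nat).congr fun n => ?_
  rw [recordVar, recordMean, sub_right_comm, ← Finset.sum_sub_distrib]
  congr 1
  exact Finset.sum_congr rfl fun k _ => by ring

theorem tendsto_recordMean_atTop : Tendsto recordMean atTop atTop := by
  have := tendsto_recordMean_sub_log.add_atTop tendsto_natCast_log_atTop
  simpa using this

/-- The envelope `4 (3/2)^r` serves indicators and both moments; against `(1/2)^r` it leaves the
summable ratio `3/4`. -/
theorem sq_le_four_mul_pow (r : ℕ) : (r : ℝ) ^ 2 ≤ 4 * (3 / 2) ^ r := by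
  rcases lt_or_ge r 5 with h | h
  · interval_cases r <;> norm_num
  · induction r, h using Nat.le_induction with
    | base => norm_num
    | succ r hr ih =>
      have h5 : (5 : ℝ) ≤ r := by exact_mod_cast hr
      rw [pow_succ (3 / 2 : ℝ)]
      push_cast
      nlinarith

theorem one_le_four_mul_pow (r : ℕ) : (1 : ℝ) ≤ 4 * (3 / 2) ^ r := by
  have := one_le_pow₀ (n := r) (by norm_num : (1 : ℝ) ≤ 3 / 2)
  linarith

theorem natCast_le_four_mul_pow (r : ℕ) : (r : ℝ) ≤ 4 * (3 / 2) ^ r := by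
  refine le_trans ?_ (sq_le_four_mul_pow r)
  exact_mod_cast Nat.le_self_pow two_ne_zero r

/-! ### Transfer of the moments -/

/-- A bound for the effect of the elimination of an action of Row. -/
noncomputable def rowEliminationError (n : ℕ) : ℝ := 8 * Real.exp (-recordMean n / 4)

theorem rowEliminationError_nonneg (n : ℕ) : 0 ≤ rowEliminationError n := by
  unfold rowEliminationError; positivity

theorem rowEliminationError_le_eight (n : ℕ) : rowEliminationError n ≤ 8 := by
  have : Real.exp (-recordMean n / 4) ≤ 1 :=
    Real.exp_le_one_iff.2 (by linarith [recordMean_nonneg n])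
  unfold rowEliminationError
  linarith

theorem pbMean_rowElimination_le (n : ℕ) {M : ℕ → ℝ} (hM : ∀ r, M r ≤ 4 * (3 / 2) ^ r) :
    pbMean recordProb (Finset.range n) (fun r => 2 * (1 / 2) ^ r * M r)
      ≤ rowEliminationError n := by
  have h1 : ∀ r, 2 * (1 / 2) ^ r * M r ≤ 8 * (3 / 4 : ℝ) ^ r := by
    intro r
    calc _ ≤ 2 * (1 / 2) ^ r * (4 * (3 / 2 : ℝ) ^ r) := by gcongr; exact hM r
      _ = 8 * ((1 / 2) * (3 / 2) : ℝ) ^ r := by rw [mul_pow]; ring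
      _ = _ := by norm_num
  refine (pbMean.mono recordProb_nonneg recordProb_le_one h1).trans ?_
  rw [pbMean.const_mul, pbMean.pow, rowEliminationError]
  refine mul_le_mul_of_nonneg_left ?_ (by norm_num)
  have h2 : -recordMean n / 4 = ∑ k ∈ Finset.range n, -((1 - 3 / 4) * recordProb k) := by
    rw [recordMean, Finset.sum_neg_distrib, ← Finset.mul_sum]
    ring
  rw [h2, Real.exp_sum]
  -- Factorwise `1 - p/4 ≤ exp(-p/4)`.
  refine Finset.prod_le_prod (fun k _ => ?_) fun k _ => ?_
  · linarith [recordProb_nonneg k, recordProb_le_one k]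
  · linarith [Real.add_one_le_exp (-((1 - 3 / 4) * recordProb k))]

theorem abs_meanSurvivingCols_sub_le (n : ℕ) :
    |meanSurvivingCols 2 n - recordMean n| ≤ rowEliminationError n := by
  have h := RankingProfile.integral_abs_sub_le n (fun t => t) (fun r => r) fun s r hsr => by
    rw [abs_sub_comm, abs_of_nonneg (by simpa using hsr)]
    linarith [Nat.cast_nonneg (α := ℝ) s]
  rw [pbMean.natCast] at h
  exact h.trans (pbMean_rowElimination_le n natCast_le_four_mul_pow)

theorem abs_integral_sq_sub_le (n : ℕ) :
    |∫ ω, numSurvivingCols 2 n ω ^ 2 ∂(randomGame 2 n) - (recordVar n + recordMean n ^ 2)|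
      ≤ rowEliminationError n := by
  have h := RankingProfile.integral_abs_sub_le n (fun t => t ^ 2) (fun r => (r : ℝ) ^ 2)
    fun s r hsr => by
      have h1 : (s : ℝ) ≤ r := by exact_mod_cast hsr
      have h0 := Nat.cast_nonneg (α := ℝ) s
      rw [abs_sub_comm, abs_of_nonneg (by nlinarith)]
      nlinarith
  have h2 : pbMean recordProb (Finset.range n) (fun r => (r : ℝ) ^ 2)
      = recordVar n + recordMean n ^ 2 := by
    have e : (fun r : ℕ => (r : ℝ) ^ 2) = fun r : ℕ =>
        ((r : ℝ) - recordMean n) ^ 2 + ((2 * recordMean n) * r - recordMean n ^ 2) := by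
      ext r; ring
    rw [e, pbMean.add, pbMean.sub, pbMean.const_mul, pbMean.const, pbMean.natCast]
    rw [recordMean, pbMean.sub_mean_sq, ← recordVar, ← recordMean]
    ring
  rw [h2] at h
  exact h.trans (pbMean_rowElimination_le n sq_le_four_mul_pow)

/-- A bound for the effect of the elimination of an action of Row on the variance. -/
noncomputable def varianceError (n : ℕ) : ℝ := rowEliminationError n * (9 + 2 * recordMean n)

theorem abs_variance_sub_le (n : ℕ) :
    |variance (numSurvivingCols 2 n) (randomGame 2 n) - recordVar n| ≤ varianceError n := by
  have hv : variance (numSurvivingCols 2 n) (randomGame 2 n)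
      = ∫ ω, numSurvivingCols 2 n ω ^ 2 ∂(randomGame 2 n) - meanSurvivingCols 2 n ^ 2 :=
    variance_eq_sub MemLp.of_discrete
  have h1 := abs_le.1 (abs_integral_sq_sub_le n)
  have h2 := abs_meanSurvivingCols_sub_le n
  have h8 := rowEliminationError_le_eight n
  have hH := recordMean_nonneg n
  rw [hv, varianceError]
  -- With `ε` the elimination error, the sum of the two means is at most `ε + 2 H_n ≤ 8 + 2 H_n`;
  -- the second moment adds one more `ε`, whence the `9`.
  have h3 : |meanSurvivingCols 2 n ^ 2 - recordMean n ^ 2|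
      ≤ rowEliminationError n * (8 + 2 * recordMean n) := by
    rw [sq_sub_sq, abs_mul, mul_comm]
    refine mul_le_mul h2 ?_ (abs_nonneg _) (rowEliminationError_nonneg n)
    have h4 := abs_le.1 h2
    rw [abs_le]
    constructor <;> linarith [h4.1, h4.2]
  have h4 := abs_le.1 h3
  rw [abs_le]
  constructor <;> nlinarith [h1.1, h1.2, h4.1, h4.2]

theorem tendsto_varianceError : Tendsto varianceError atTop (nhds 0) := by
  have h1 : Tendsto (fun x : ℝ => 8 * Real.exp (-x / 4) * (9 + 2 * x)) atTop (nhds 0) := by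
    have h2 := (Real.tendsto_pow_mul_exp_neg_atTop_nhds_zero 0).const_mul 72
    have h3 := (Real.tendsto_pow_mul_exp_neg_atTop_nhds_zero 1).const_mul 64
    have h4 := (h2.add h3).comp (tendsto_id.atTop_div_const (by norm_num : (0 : ℝ) < 4))
    simp only [mul_zero, add_zero] at h4
    refine h4.congr fun x => ?_
    simp only [Function.comp, id, neg_div]
    ring
  exact h1.comp tendsto_recordMean_atTop

theorem tendsto_rowEliminationError : Tendsto rowEliminationError atTop (nhds 0) := by
  refine squeeze_zero rowEliminationError_nonneg (fun n => ?_) tendsto_varianceError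
  rw [varianceError]
  nlinarith [rowEliminationError_nonneg n, recordMean_nonneg n,
    mul_nonneg (rowEliminationError_nonneg n) (recordMean_nonneg n)]

/-! ### Normal approximation of the surviving actions -/

theorem abs_real_sub_stdCDF_le {n : ℕ} (hv : 4 ≤ recordVar n) (hδ : varianceError n ≤ 1) (x : ℝ) :
    |(randomGame 2 n).real
        {ω | numSurvivingCols 2 n ω - meanSurvivingCols 2 n ≤ x * sdSurvivingCols 2 n}
      - stdCDF x| ≤ 17 / √(recordVar n) := by
  set σ := √(recordVar n) with hσdef
  set s := sdSurvivingCols 2 n with hs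
  set m := meanSurvivingCols 2 n with hm
  have hσ2 : recordVar n = σ ^ 2 := (Real.sq_sqrt (recordVar_nonneg n)).symm
  have hσ : 2 ≤ σ := Real.le_sqrt_of_sq_le (by linarith)
  have hs0 : 0 ≤ s := Real.sqrt_nonneg _
  have hs2 : variance (numSurvivingCols 2 n) (randomGame 2 n) = s ^ 2 :=
    (Real.sq_sqrt (variance_nonneg _ _)).symm
  have hσ0 : 0 < σ := by linarith
  have hε0 := rowEliminationError_nonneg n
  -- From `ε (9 + 2 H_n) ≤ 1` and `H_n ≥ σ² ≥ σ`.
  have hε : rowEliminationError n ≤ 1 / σ := by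
    rw [le_div_iff₀ hσ0]
    have h1 := recordVar_le_recordMean n
    rw [varianceError] at hδ
    nlinarith [mul_nonneg hε0 (recordMean_nonneg n),
      mul_nonneg hε0 (show 0 ≤ recordMean n - σ by nlinarith)]
  -- From `|s² - σ²| ≤ 1` one gets `|s/σ - 1| ≤ 1/σ²`, and `σ ≥ 2`.
  have hα : |s / σ - 1| ≤ 1 / (2 * σ) := by
    have h1 := abs_variance_sub_le n
    rw [hs2, hσ2, sq_sub_sq, abs_mul, abs_of_nonneg (by positivity : 0 ≤ s + σ)] at h1
    rw [div_sub_one hσ0.ne', abs_div, abs_of_pos hσ0, div_le_div_iff₀ hσ0 (by positivity)]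
    have h2 := abs_nonneg (s - σ)
    nlinarith
  have hα2 : 1 / 2 ≤ s / σ := by
    have h1 : 1 / (2 * σ) ≤ 1 / 2 := by
      apply one_div_le_one_div_of_le <;> linarith
    linarith [(abs_le.1 hα).1]
  have hβ : |(m - recordMean n) / σ| ≤ 1 / σ := by
    rw [abs_div, abs_of_pos hσ0]
    refine div_le_div_of_nonneg_right ?_ hσ0.le
    refine (abs_meanSurvivingCols_sub_le n).trans (hε.trans ?_)
    rw [div_le_one hσ0]
    linarith
  have hP : (randomGame 2 n).real {ω | numSurvivingCols 2 n ω - m ≤ x * s}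
      = ∫ ω, (fun t => if t - m ≤ x * s then (1 : ℝ) else 0) (numSurvivingCols 2 n ω)
          ∂(randomGame 2 n) := by
    rw [← integral_indicator_one (MeasurableSet.of_discrete)]
    rfl
  have h1 := RankingProfile.integral_abs_sub_le n (fun t => if t - m ≤ x * s then (1 : ℝ) else 0)
    (fun _ => 1) fun a b _ => by split_ifs <;> norm_num
  have h2 := h1.trans (pbMean_rowElimination_le n one_le_four_mul_pow)
  have h3 := pbMean.berryEsseen (s := Finset.range n) recordProb_nonneg recordProb_le_one
    (by linarith : 1 ≤ σ) hσ2 (s / σ * x + (m - recordMean n) / σ)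
  have h4 : (fun r : ℕ => if ((r : ℝ) - ∑ i ∈ Finset.range n, recordProb i) / σ
        ≤ s / σ * x + (m - recordMean n) / σ then (1 : ℝ) else 0)
      = fun r : ℕ => if (r : ℝ) - m ≤ x * s then 1 else 0 := by
    ext r
    congr 1
    rw [← recordMean, div_mul_eq_mul_div, ← add_div, div_le_div_iff_of_pos_right hσ0, eq_iff_iff]
    constructor <;> intro h <;> linarith
  rw [h4] at h3
  have h5 := abs_stdCDF_affine_sub_le hα2 ((m - recordMean n) / σ) x
  rw [hP]
  have e1 : 1 / (2 * σ) = (1 / σ) / 2 := by rw [div_div, mul_comm]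
  have e2 : 13 / σ = 13 * (1 / σ) := by ring
  have e3 : 17 / σ = 17 * (1 / σ) := by ring
  have e0 : 0 ≤ 1 / σ := by positivity
  have h2' := abs_le.1 h2
  have h3' := abs_le.1 h3
  have h5' := abs_le.1 h5
  rw [e3, abs_le]
  rw [e2] at h3'
  rw [e1] at hα
  -- Berry–Esseen costs `13/σ`; elimination, the shift of the mean and the change of scale cost
  -- `1/σ` each.
  constructor
  · linarith [h2'.1, h3'.1, h5'.1]
  · linarith [h2'.2, h3'.2, h5'.2]

theorem exists_berryEsseen_bound :
    ∃ K : ℝ, ∀ n : ℕ, 2 ≤ n → ∀ x : ℝ,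
      |(randomGame 2 n).real
          {ω | numSurvivingCols 2 n ω - meanSurvivingCols 2 n ≤ x * sdSurvivingCols 2 n}
        - stdCDF x| ≤ K / √(Real.log n) := by
  have hvar : ∀ᶠ n : ℕ in atTop, Real.log n / 4 ≤ recordVar n := by
    have h1 := tendsto_recordVar_sub_log.eventually
      (lt_mem_nhds (sub_one_lt (Real.eulerMascheroniConstant - Real.pi ^ 2 / 6)))
    filter_upwards [h1, tendsto_natCast_log_atTop.eventually_ge_atTop
      (-2 * (Real.eulerMascheroniConstant - Real.pi ^ 2 / 6 - 1)),
      tendsto_natCast_log_atTop.eventually_ge_atTop 0] with n h1 h2 h3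
    linarith
  obtain ⟨N, hN⟩ := eventually_atTop.1 (hvar.and
    ((tendsto_natCast_log_atTop.eventually_ge_atTop 16).and
      (tendsto_varianceError.eventually (ge_mem_nhds zero_lt_one))))
  -- For `n ≥ N`, `√(recordVar n) ≥ √(ln n)/2` doubles `17`; for `n < N` the difference is at most
  -- `1 ≤ √(ln N)/√(ln n)`.
  refine ⟨max 34 √(Real.log N), fun n hn x => ?_⟩
  have hlog : 0 < Real.log n := Real.log_pos (by exact_mod_cast hn)
  have hsq := Real.sqrt_pos.2 hlog
  rcases le_or_gt N n with h | h
  · obtain ⟨h1, h2, h3⟩ := hN n h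
    refine (abs_real_sub_stdCDF_le (by linarith) h3 x).trans ?_
    have h4 : √(Real.log n) / 2 ≤ √(recordVar n) := by
      refine Real.le_sqrt_of_sq_le ?_
      rw [div_pow, Real.sq_sqrt hlog.le]
      linarith
    calc 17 / √(recordVar n) ≤ 17 / (√(Real.log n) / 2) := by gcongr
      _ = 34 / √(Real.log n) := by field_simp; norm_num
      _ ≤ _ := by gcongr; exact le_max_left _ _
  · have h1 : |(randomGame 2 n).real
          {ω | numSurvivingCols 2 n ω - meanSurvivingCols 2 n ≤ x * sdSurvivingCols 2 n}
        - stdCDF x| ≤ 1 := by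
      refine abs_sub_le_of_nonneg_of_le measureReal_nonneg measureReal_le_one
        (cdf_nonneg _ x) (cdf_le_one _ x)
    refine h1.trans ((one_le_div hsq).2 (le_max_of_le_right (Real.sqrt_le_sqrt ?_)))
    exact Real.log_le_log (by positivity) (by exact_mod_cast h.le)

theorem tendsto_variance_sub_log :
    Tendsto (fun n : ℕ => variance (numSurvivingCols 2 n) (randomGame 2 n) - Real.log n) atTop
      (nhds (Real.eulerMascheroniConstant - Real.pi ^ 2 / 6)) := by
  have h1 := squeeze_zero_norm (f := fun n =>
    variance (numSurvivingCols 2 n) (randomGame 2 n) - recordVar n) abs_variance_sub_le tendsto_varianceError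
  have h2 := h1.add tendsto_recordVar_sub_log
  rw [zero_add] at h2
  refine h2.congr fun n => ?_
  ring

theorem tendsto_meanSurvivingCols_sub_log :
    Tendsto (fun n : ℕ =>
      meanSurvivingCols 2 n - (Real.log n + Real.eulerMascheroniConstant)) atTop (nhds 0) := by
  have h1 := squeeze_zero_norm (f := fun n => meanSurvivingCols 2 n - recordMean n)
    abs_meanSurvivingCols_sub_le tendsto_rowEliminationError
  have h2 := h1.add (tendsto_recordMean_sub_log.sub_const Real.eulerMascheroniConstant)
  rw [sub_self, zero_add] at h2
  refine h2.congr fun n => ?_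
  ring

theorem proposition3 :
    (∃ K : ℝ, ∀ n : ℕ, 2 ≤ n → ∀ x : ℝ,
      |(randomGame 2 n).real
          {ω | numSurvivingCols 2 n ω - meanSurvivingCols 2 n ≤ x * sdSurvivingCols 2 n}
        - cdf (gaussianReal 0 1) x| ≤ K / √(Real.log n)) ∧
    ((fun n : ℕ => meanSurvivingCols 2 n - (Real.log n + Real.eulerMascheroniConstant))
      =o[atTop] fun _ : ℕ => (1 : ℝ)) ∧
    ((fun n : ℕ => sdSurvivingCols 2 n -
        (√(Real.log n) -
          (Real.pi ^ 2 - 6 * Real.eulerMascheroniConstant) / (12 * √(Real.log n))))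
      =o[atTop] fun n : ℕ => 1 / √(Real.log n)) := by
  refine ⟨exists_berryEsseen_bound,
    (isLittleO_one_iff ℝ).2 tendsto_meanSurvivingCols_sub_log, ?_⟩
  refine (sqrt_sub_isLittleO tendsto_natCast_log_atTop tendsto_variance_sub_log).congr_left
    fun n => ?_
  rw [sdSurvivingCols]
  -- If `ln n = 0`, division by zero makes both correction terms `0`; otherwise `(γ - π²/6)/2 = -(π²
  -- - 6γ)/12`.
  rcases eq_or_ne √(Real.log n) 0 with h | h
  · simp [h]
  · field_simp
    ring
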